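/- Let $k$ be a finite field, let $\sigma$ be an automorphism of $k$, let $r$ be the order of $\sigma$, and let $k^\sigma=\{a\in k:\sigma(a)=a\}$. Let $k[X,\sigma]$ be the ring of skew polynomials $\sum_i a_iX^i$ ($a_i\in k$), with the usual addition and the multiplication determined by $Xa=\sigma(a)X$ for all $a\in k$, and let $k[X,\sigma][1/X]$ be its localization at the powers of $X$. Then the centre of $k[X,\sigma][1/X]$ is $k^\sigma[X^r][1/X^r]$, the ring of Laurent polynomials in $X^r$ with coefficients in $k^\sigma$; that is, there is a ring isomorphism from the Laurent polynomial ring $k^\sigma[T,T^{-1}]$ onto the centre which is the identity on the constants $k^\sigma$ and sends $T$ to $X^r$. Moreover, $k[X,\sigma][1/X]$ is an Azumaya algebra over its centre. Here an algebra $A$ over a commutative ring $C$ is called Azumaya if $A$ is a finitely generated, projective and faithful $C$-module and the map $A\otimes_C A^{\mathrm{op}}\to\operatorname{End}_C(A)$, $a\otimes b\mapsto(x\mapsto axb)$, is bijective. -/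

import Mathlib

/-- A copy of the field `k`, carrying the action of `ℕ` through the powers of the automorphism `σ`.
It is the coefficient ring of the skew polynomials `k[X, σ]`. -/
def Twist {k : Type*} [Field k] (_σ : RingAut k) : Type _ := k

namespace Twist

variable {k : Type*} [Field k] (σ : RingAut k)

noncomputable instance : Field (Twist σ) := inferInstanceAs (Field k)

/-- The identity map from `k` to its copy. -/
def of : k ≃+* Twist σ := RingEquiv.refl k

/-- The natural number `n` acts as `σ ^ n`. -/
noncomputable instance : MulSemiringAction (Multiplicative ℕ) (Twist σ) where
  smul n a := of σ ((σ ^ n.toAdd) ((of σ).symm a))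
  one_smul _ := rfl
  mul_smul m n a := by
    change (σ ^ (m.toAdd + n.toAdd)) _ = (σ ^ m.toAdd) ((σ ^ n.toAdd) _)
    rw [pow_add]; rfl
  smul_zero n := map_zero (σ ^ n.toAdd)
  smul_add n := map_add (σ ^ n.toAdd)
  smul_one n := map_one (σ ^ n.toAdd)
  smul_mul n := map_mul (σ ^ n.toAdd)

end Twist

/-- The skew polynomial ring `k[X, σ]`, in which `X * a = σ a * X`. -/
abbrev SkewPoly {k : Type*} [Field k] (σ : RingAut k) : Type _ := SkewPolynomial (Twist σ)

namespace SkewPoly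

variable {k : Type*} [Field k] (σ : RingAut k)

/-- The embedding of `k` into `k[X, σ]` as the constants. -/
noncomputable def const : k →+* SkewPoly σ :=
  SkewPolynomial.CRingHom.comp (Twist.of σ).toRingHom

/-- The defining relation of the skew polynomial ring. -/
theorem X_mul_const (a : k) :
    (SkewPolynomial.X : SkewPoly σ) * const σ a = const σ (σ a) * SkewPolynomial.X := by
  change SkewPolynomial.monomial 1 1 * SkewPolynomial.monomial 0 (Twist.of σ a) =
    SkewPolynomial.monomial 0 (Twist.of σ (σ a)) * SkewPolynomial.monomial 1 1
  rw [SkewPolynomial.monomial_mul_monomial, SkewPolynomial.monomial_mul_monomial]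
  simp only [one_mul, mul_one, Function.iterate_zero, id, Function.iterate_one, zero_add, add_zero]
  rfl

theorem X_mul_eq (p : SkewPoly σ) :
    ∃ q : SkewPoly σ, SkewPolynomial.X * p = q * SkewPolynomial.X := by
  induction p using SkewPolynomial.induction with
  | h0 => exact ⟨0, by simp⟩
  | ha n a q _ _ ih =>
    obtain ⟨q', hq'⟩ := ih
    refine ⟨SkewPolynomial.monomial n (SkewPolynomial.φ a) + q', ?_⟩
    rw [mul_add, add_mul, hq', SkewPolynomial.X, SkewPolynomial.monomial_mul_monomial,
      SkewPolynomial.monomial_mul_monomial, add_comm 1 n]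
    simp

theorem coeff_mul_X (p : SkewPoly σ) (n : ℕ) :
    (p * SkewPolynomial.X).coeff (n + 1) = p.coeff n := by
  induction p using SkewPolynomial.induction with
  | h0 => simp
  | ha m a q _ _ ih =>
    rw [add_mul, SkewPolynomial.coeff_add, ih, SkewPolynomial.coeff_add, SkewPolynomial.X,
      SkewPolynomial.monomial_mul_monomial, SkewPolynomial.coeff_monomial,
      SkewPolynomial.coeff_monomial]
    simp

/-- The powers of `X` form a (left) Ore set, so that one can invert `X`. -/
noncomputable instance : OreLocalization.OreSet
    (Submonoid.powers (SkewPolynomial.X : SkewPoly σ)) :=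
  Classical.choice <| OreLocalization.nonempty_oreSet_iff.2 <| by
    constructor
    · rintro p q ⟨_, n, rfl⟩ h
      refine ⟨1, ?_⟩
      have key : p = q := by
        induction n with
        | zero => simpa using h
        | succ n ih =>
          apply ih
          simp only [pow_succ, ← mul_assoc] at h
          ext m
          rw [← coeff_mul_X, h, coeff_mul_X]
      rw [key]
    · rintro p ⟨_, n, rfl⟩
      have key : ∃ q : SkewPoly σ,
          SkewPolynomial.X ^ n * p = q * SkewPolynomial.X ^ n := by
        induction n with
        | zero => exact ⟨p, by simp⟩
        | succ n ih =>
          obtain ⟨q, hq⟩ := ih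
          obtain ⟨q', hq'⟩ := X_mul_eq σ q
          refine ⟨q', ?_⟩
          rw [pow_succ', mul_assoc, hq, ← mul_assoc, hq', mul_assoc]
      obtain ⟨q, hq⟩ := key
      exact ⟨q, ⟨_, n, rfl⟩, hq⟩

end SkewPoly

/-- The ring `k[X, σ][1/X]`. -/
abbrev SkewLaurent {k : Type*} [Field k] (σ : RingAut k) : Type _ :=
  OreLocalization (Submonoid.powers (SkewPolynomial.X : SkewPoly σ)) (SkewPoly σ)

namespace SkewLaurent

variable {k : Type*} [Field k] (σ : RingAut k)

/-- The canonical map `k[X, σ] → k[X, σ][1/X]`. -/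
noncomputable def ofPoly : SkewPoly σ →+* SkewLaurent σ := OreLocalization.numeratorRingHom

/-- The embedding of `k` into `k[X, σ][1/X]` as the constants. -/
noncomputable def const : k →+* SkewLaurent σ := (ofPoly σ).comp (SkewPoly.const σ)

/-- The element `X` of `k[X, σ][1/X]`. -/
noncomputable def X : SkewLaurent σ := ofPoly σ SkewPolynomial.X

end SkewLaurent

/-- The subfield `k^σ` of `k` fixed by `σ`. -/
abbrev fixedSubfield {k : Type*} [Field k] (σ : RingAut k) : Subfield k :=
  RingHom.eqLocusField (σ : k →+* k) (RingHom.id k)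

/-!
Write `r` for the order of `σ`, which is finite because `k` is, and `A` for `k[X, σ][1/X]`.

**The centre.** An element of `A` times a large power of the central element `X ^ r` is a skew
polynomial `∑ aₙ Xⁿ`. Commuting with `X` forces `σ aₙ = aₙ`, and commuting with the constants forces
`aₙ = 0` unless `σ ^ n = 1`, that is `r ∣ n` (`SkewPoly.coeff_of_commute`). So the evaluation
`SkewLaurent.laurentToCenter`, `T ↦ X ^ r`, is onto the centre; it is injective since `k[X, σ]`
embeds in `A`.

**The Azumaya property.** The criterion `isAzumaya_of_casimir` asks for finitely many `e i` in `A`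
and `t i` in `A ⊗ Aᵐᵒᵖ`, tensors over the centre, with `(b ⊗ 1) t i = (1 ⊗ b) t i` for all `b` and
`∑ i, (e i ⊗ 1) t i = 1`. To find them, Dedekind's independence of automorphisms provides
`β : k → k` with `∑ a, β a * τ a` equal to `1` for `τ = 1` and to `0` for every other automorphism
(`exists_sum_mul_ringAut_eq_ite`); this is the Galois property of `k` over `k^σ` in explicit form.
Then `s = ∑ a, β a ⊗ a` satisfies the Casimir identity for constants, and averaging it over the
powers `Xᵐ`, `m < r`, gives the tensor `t = ∑ m, (Xᵐ ⊗ X⁻ᵐ) s`, which satisfies it for `X` as well,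
hence on all of `A`. The identity is preserved by right multiplication, and the families
`e = β l * X⁻ⁿ` and `t * (l ⊗ Xⁿ)`, indexed by `n < r` and `l ∈ k`, meet the criterion
(`sum_mul_crossedCasimir_mul`).
-/

/-! ### Azumaya algebras from Casimir elements -/

section Casimir

open TensorProduct MulOpposite

variable {A : Type*} [Ring A]

theorem center_smul_tmul_op (z : Subring.center A) (p q : A) :
    (p * z) ⊗ₜ[Subring.center A] op q = p ⊗ₜ op (z * q) := by
  have h1 : p * z = z • p := by
    rw [Subring.smul_def, smul_eq_mul, Subring.mem_center_iff.1 z.2 p]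
  have h2 : op (z * q) = z • op q := rfl
  rw [h1, h2, TensorProduct.smul_tmul]

/-- The Casimir property of `t`, the identity `(b ⊗ 1) t = (1 ⊗ b) t`, makes `t` act on `A` as a
central-valued functional. The hypotheses say that the `t i` give such functionals dual to the
`e i`, already at the level of `A ⊗ Aᵐᵒᵖ`: this is what makes `f ↦ ∑ i, (f (e i) ⊗ 1) t i` inverse
to the map from `A ⊗ Aᵐᵒᵖ` to the endomorphisms of `A`. -/
theorem isAzumaya_of_casimir {ι : Type*} [Fintype ι] (e : ι → A)
    (t : ι → A ⊗[Subring.center A] Aᵐᵒᵖ)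
    (ht : ∀ i (b : A), (b ⊗ₜ 1) * t i = (1 ⊗ₜ op b) * t i)
    (he : ∑ i, (e i ⊗ₜ 1) * t i = 1) : IsAzumaya (Subring.center A) A := by
  set Φ := AlgHom.mulLeftRight (Subring.center A) A with hΦ
  have hleft (a : A) (s) (z : A) : Φ ((a ⊗ₜ 1) * s) z = a * Φ s z := by
    rw [map_mul, Module.End.mul_apply, hΦ, AlgHom.mulLeftRight_apply, unop_one, mul_one]
  have hright (a : A) (s) (z : A) : Φ ((1 ⊗ₜ op a) * s) z = Φ s z * a := by
    rw [map_mul, Module.End.mul_apply, hΦ, AlgHom.mulLeftRight_apply, unop_op, one_mul]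
  have hcen (i) (z : A) : Φ (t i) z ∈ Subring.center A :=
    Subring.mem_center_iff.2 fun b ↦ by rw [← hleft, ht, hright]
  let φ (i : ι) : A →ₗ[Subring.center A] Subring.center A :=
    { toFun z := ⟨Φ (t i) z, hcen i z⟩
      map_add' x y := Subtype.ext (map_add (Φ (t i)) x y)
      map_smul' c x := Subtype.ext (map_smul (Φ (t i)) c x) }
  have hdual (z : A) : ∑ i, φ i z • e i = z := by
    calc ∑ i, φ i z • e i = ∑ i, Φ ((e i ⊗ₜ 1) * t i) z :=
          Finset.sum_congr rfl fun i _ ↦ by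
            rw [hleft, Subring.mem_center_iff.1 (hcen i z) (e i)]; rfl
      _ = Φ (∑ i, (e i ⊗ₜ 1) * t i) z := by rw [map_sum, LinearMap.sum_apply]
      _ = z := by rw [he, map_one, Module.End.one_apply]
  let s : (ι → Subring.center A) →ₗ[Subring.center A] A := Fintype.linearCombination _ e
  have hs : s ∘ₗ LinearMap.pi φ = LinearMap.id := LinearMap.ext fun z ↦ by
    simpa [s, Fintype.linearCombination_apply] using hdual z
  have hproj : Module.Projective (Subring.center A) A := .of_split (LinearMap.pi φ) s hs
  have hfin : Module.Finite (Subring.center A) A :=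
    .of_surjective s fun z ↦ ⟨LinearMap.pi φ z, LinearMap.congr_fun hs z⟩
  have hfaith : FaithfulSMul (Subring.center A) A := inferInstance
  have hrec (u : A ⊗[Subring.center A] Aᵐᵒᵖ) : ∑ i, (Φ u (e i) ⊗ₜ 1) * t i = u := by
    induction u with
    | zero => simp
    | add x y hx hy => simp only [map_add, LinearMap.add_apply, add_tmul, add_mul,
        Finset.sum_add_distrib, hx, hy]
    | tmul a b =>
      calc ∑ i, (Φ (a ⊗ₜ b) (e i) ⊗ₜ 1) * t i
          = ∑ i, (a ⊗ₜ b) * ((e i ⊗ₜ 1) * t i) := Finset.sum_congr rfl fun i _ ↦ by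
            rw [hΦ, AlgHom.mulLeftRight_apply]
            calc ((a * e i * unop b) ⊗ₜ 1) * t i
                = ((a * e i) ⊗ₜ 1) * ((unop b ⊗ₜ 1) * t i) := by
                  rw [← mul_assoc, Algebra.TensorProduct.tmul_mul_tmul, one_mul]
              _ = (a ⊗ₜ b) * ((e i ⊗ₜ 1) * t i) := by
                  rw [ht, ← mul_assoc, ← mul_assoc, Algebra.TensorProduct.tmul_mul_tmul,
                    Algebra.TensorProduct.tmul_mul_tmul, op_unop, mul_one, one_mul, mul_one]
        _ = a ⊗ₜ b := by rw [← Finset.mul_sum, he, mul_one]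
  refine { hproj, hfaith, hfin with bij := ⟨fun u v huv ↦ ?_, fun f ↦ ?_⟩ }
  · rw [← hrec u, ← hrec v]
    exact congrArg (fun f : Module.End _ A ↦ ∑ i, (f (e i) ⊗ₜ 1) * t i) huv
  · refine ⟨∑ i, (f (e i) ⊗ₜ 1) * t i, LinearMap.ext fun z ↦ ?_⟩
    calc Φ (∑ i, (f (e i) ⊗ₜ 1) * t i) z = ∑ i, φ i z • f (e i) := by
          rw [map_sum, LinearMap.sum_apply]
          exact Finset.sum_congr rfl fun i _ ↦ by
            rw [hleft, Subring.mem_center_iff.1 (hcen i z)]; rfl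
      _ = f z := by simp only [← map_smul, ← map_sum, hdual]

end Casimir

/-! ### Dual families in a finite field -/

theorem finite_ringAut (k : Type*) [Field k] [Finite k] : Finite (RingAut k) :=
  .of_injective (fun τ : RingAut k ↦ (τ : k → k)) DFunLike.coe_injective

/-- By Dedekind's independence of automorphisms the vectors `(τ a)_τ` span `k ^ Aut k`, so the
indicator of the identity is a combination of them. -/
theorem exists_sum_mul_ringAut_eq_ite (k : Type*) [Field k] [Fintype k] [DecidableEq (RingAut k)] :
    ∃ β : k → k, ∀ τ : RingAut k, ∑ a, β a * τ a = if τ = 1 then 1 else 0 := by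
  have := finite_ringAut k
  have := Fintype.ofFinite (RingAut k)
  let v (a : k) : RingAut k → k := fun τ ↦ τ a
  have hspan : Submodule.span k (Set.range v) = ⊤ := by
    by_contra h
    obtain ⟨f, hf, hle⟩ := Submodule.exists_le_ker_of_lt_top _ (lt_top_iff_ne_top.2 h)
    have hind : LinearIndependent k (fun τ : RingAut k ↦ (τ : k → k)) :=
      (linearIndependent_monoidHom k k).comp (fun τ : RingAut k ↦ ((τ : k →+* k) : k →* k))
        fun τ τ' h ↦ RingEquiv.ext fun a ↦ DFunLike.congr_fun h a
    refine hf (LinearMap.pi_ext' fun τ ↦ LinearMap.ext_ring ?_)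
    refine Fintype.linearIndependent_iff.1 hind (fun τ ↦ f (Pi.single τ 1)) (funext fun a ↦ ?_) τ
    have ha : f (v a) = 0 := hle (Submodule.subset_span ⟨a, rfl⟩)
    rw [LinearMap.pi_apply_eq_sum_univ f] at ha
    rw [Finset.sum_apply, Pi.zero_apply, ← ha]
    refine Finset.sum_congr rfl fun τ _ ↦ ?_
    rw [Pi.smul_apply, smul_eq_mul, mul_comm, smul_eq_mul]
    congr 2
    ext τ'
    simp [Pi.single_apply, eq_comm]
  have hmem : (fun τ : RingAut k ↦ if τ = 1 then (1 : k) else 0) ∈ Submodule.span k (Set.range v) :=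
    hspan ▸ Submodule.mem_top
  obtain ⟨β, hβ⟩ := (Submodule.mem_span_range_iff_exists_fun k).1 hmem
  exact ⟨β, fun τ ↦ by simpa [v] using congrFun hβ τ⟩

/-! ### Crossed products by a cyclic group -/

section CrossedProduct

open TensorProduct MulOpposite

variable {k A : Type*} [Field k] [Ring A] {σ : RingAut k} {c : k →+* A} {x : Aˣ}

theorem units_zpow_mul_const (h : ∀ a, x * c a = c (σ a) * x) (n : ℤ) (a : k) :
    (x ^ n : Aˣ) * c a = c ((σ ^ n) a) * (x ^ n : Aˣ) := by
  have hinv (a : k) : (x⁻¹ : Aˣ) * c a = c (σ⁻¹ a) * (x⁻¹ : Aˣ) := by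
    rw [Units.inv_mul_eq_iff_eq_mul, ← mul_assoc, h, Units.eq_mul_inv_iff_mul_eq]
    congr 2
    exact (σ.apply_symm_apply a).symm
  induction n generalizing a with
  | zero => simp
  | succ n ih =>
    rw [zpow_add_one, Units.val_mul, mul_assoc, h, ← mul_assoc, ih, zpow_add_one, mul_assoc]; rfl
  | pred n ih =>
    rw [zpow_sub_one, Units.val_mul, mul_assoc, hinv, ← mul_assoc, ih, zpow_sub_one, mul_assoc]; rfl

/-- The trace from `k` to the fixed field of `σ`: the sum of `σ ^ n a` over one period of `σ`. It is
`0` when `σ` has infinite order. -/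
noncomputable def cyclicTrace (σ : RingAut k) (a : k) : k :=
  ∑ n ∈ Finset.range (orderOf σ), (σ ^ n) a

theorem apply_cyclicTrace (σ : RingAut k) (a : k) : σ (cyclicTrace σ a) = cyclicTrace σ a := by
  rw [cyclicTrace, map_sum, ← sub_eq_zero, ← Finset.sum_sub_distrib]
  have := Finset.sum_range_sub (fun n ↦ (σ ^ n) a) (orderOf σ)
  rw [pow_orderOf_eq_one, pow_zero, sub_self] at this
  rw [← this]
  exact Finset.sum_congr rfl fun n _ ↦ by rw [pow_succ']; rfl

theorem pow_eq_one_iff_of_lt_orderOf {n : ℕ} (hn : n < orderOf σ) : σ ^ n = 1 ↔ n = 0 :=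
  ⟨fun h ↦ Nat.eq_zero_of_dvd_of_lt (orderOf_dvd_of_pow_eq_one h) hn, fun h ↦ by rw [h, pow_zero]⟩

section Fintype

variable [Fintype k] [DecidableEq (RingAut k)] {β : k → k}

theorem sum_ringAut_mul (hβ : ∀ τ : RingAut k, ∑ a, β a * τ a = if τ = 1 then 1 else 0)
    (τ : RingAut k) : ∑ a, τ (β a) * a = if τ = 1 then 1 else 0 := by
  calc ∑ a, τ (β a) * a = ∑ a, τ (β a * τ⁻¹ a) :=
        Finset.sum_congr rfl fun a _ ↦ by
          rw [map_mul]
          exact congrArg (τ (β a) * ·) (τ.apply_symm_apply a).symm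
    _ = τ (if τ⁻¹ = 1 then 1 else 0) := by rw [← map_sum, hβ]
    _ = if τ = 1 then 1 else 0 := by rw [apply_ite τ, map_one, map_zero]; simp only [inv_eq_one]

theorem sum_mul_cyclicTrace (hσ : 0 < orderOf σ)
    (hβ : ∀ τ : RingAut k, ∑ a, β a * τ a = if τ = 1 then 1 else 0) (y : k) :
    ∑ a, β a * cyclicTrace σ (a * y) = y := by
  simp only [cyclicTrace, Finset.mul_sum, map_mul, ← mul_assoc]
  rw [Finset.sum_comm]
  simp only [← Finset.sum_mul, hβ]
  rw [Finset.sum_eq_single_of_mem 0 (Finset.mem_range.2 hσ)]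
  · simp
  · intro n hn h0
    rw [if_neg (mt (pow_eq_one_iff_of_lt_orderOf (Finset.mem_range.1 hn)).1 h0), zero_mul]

theorem sum_cyclicTrace_mul (hσ : 0 < orderOf σ)
    (hβ : ∀ τ : RingAut k, ∑ a, β a * τ a = if τ = 1 then 1 else 0) (y : k) :
    ∑ a, cyclicTrace σ (y * β a) * a = y := by
  simp only [cyclicTrace, Finset.sum_mul, map_mul, mul_assoc]
  rw [Finset.sum_comm]
  simp only [← Finset.mul_sum, sum_ringAut_mul hβ]
  rw [Finset.sum_eq_single_of_mem 0 (Finset.mem_range.2 hσ)]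
  · simp
  · intro n hn h0
    rw [if_neg (mt (pow_eq_one_iff_of_lt_orderOf (Finset.mem_range.1 hn)).1 h0), mul_zero]

/-- The tensor `∑ c (β a) ⊗ c a`, which satisfies the Casimir identity for the elements of `k`. -/
noncomputable def coefficientCasimir (c : k →+* A) (β : k → k) : A ⊗[Subring.center A] Aᵐᵒᵖ :=
  ∑ a, c (β a) ⊗ₜ op (c a)

/-- The averaged tensor `∑ xᵐ c (β a) ⊗ c a x⁻ᵐ`, with `m` running over one period of `σ`. -/
noncomputable def crossedCasimir (σ : RingAut k) (c : k →+* A) (x : Aˣ) (β : k → k) :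
    A ⊗[Subring.center A] Aᵐᵒᵖ :=
  ∑ m ∈ Finset.range (orderOf σ),
    ((x ^ (m : ℤ) : Aˣ) : A) ⊗ₜ op ((x ^ (-m : ℤ) : Aˣ) : A) * coefficientCasimir c β

theorem const_mul_coefficientCasimir (hσ : 0 < orderOf σ)
    (hβ : ∀ τ : RingAut k, ∑ a, β a * τ a = if τ = 1 then 1 else 0)
    (hc : ∀ a, σ a = a → c a ∈ Subring.center A) (y : k) :
    (c y ⊗ₜ 1) * coefficientCasimir c β = (1 ⊗ₜ op (c y)) * coefficientCasimir c β := by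
  have htr (a : k) := hc _ (apply_cyclicTrace σ a)
  simp only [coefficientCasimir, Finset.mul_sum, Algebra.TensorProduct.tmul_mul_tmul, one_mul,
    ← op_mul, ← map_mul]
  -- Expand `y * β a` through the trace, and move the central traces across the tensor sign.
  calc ∑ a, c (y * β a) ⊗ₜ[Subring.center A] op (c a)
      = ∑ a, ∑ b, (c (β b) * c (cyclicTrace σ (b * y * β a))) ⊗ₜ op (c a) :=
        Finset.sum_congr rfl fun a _ ↦ by
          conv_lhs => rw [← sum_mul_cyclicTrace hσ hβ (y * β a), map_sum, sum_tmul]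
          simp only [map_mul, mul_assoc]
    _ = ∑ b, ∑ a, c (β b) ⊗ₜ op (c (cyclicTrace σ (b * y * β a)) * c a) := by
        rw [Finset.sum_comm]
        exact Finset.sum_congr rfl fun b _ ↦ Finset.sum_congr rfl fun a _ ↦
          center_smul_tmul_op ⟨_, htr _⟩ _ _
    _ = ∑ b, c (β b) ⊗ₜ op (c (b * y)) := Finset.sum_congr rfl fun b _ ↦ by
        rw [← tmul_sum, ← Finset.op_sum]
        simp only [← map_mul, ← map_sum]
        rw [sum_cyclicTrace_mul hσ hβ]

/-- The elements `b` for which the identity holds form a subring, which contains the generators: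
moving `x` across shifts the index `m` by one in a sum over a whole period. -/
theorem mul_crossedCasimir (hσ : 0 < orderOf σ) (h : ∀ a, x * c a = c (σ a) * x)
    (hβ : ∀ τ : RingAut k, ∑ a, β a * τ a = if τ = 1 then 1 else 0)
    (hc : ∀ a, σ a = a → c a ∈ Subring.center A)
    (hx : ((x ^ orderOf σ : Aˣ) : A) ∈ Subring.center A)
    (hgen : Subring.closure (Set.range c ∪ {(x : A), ((x⁻¹ : Aˣ) : A)}) = ⊤) (b : A) :
    (b ⊗ₜ 1) * crossedCasimir σ c x β = (1 ⊗ₜ op b) * crossedCasimir σ c x β := by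
  have hx' : ((x : A) ⊗ₜ 1) * crossedCasimir σ c x β =
      (1 ⊗ₜ op (x : A)) * crossedCasimir σ c x β := by
    let w (m : ℕ) : A ⊗[Subring.center A] Aᵐᵒᵖ :=
      ((x ^ (m : ℤ) : Aˣ) : A) ⊗ₜ op ((x ^ (-m : ℤ) : Aˣ) : A)
    have hw (m : ℕ) : ((x : A) ⊗ₜ 1) * w m = (1 ⊗ₜ op (x : A)) * w (m + 1) := by
      simp only [w, Algebra.TensorProduct.tmul_mul_tmul, one_mul, ← op_mul, ← Units.val_mul]
      rw [← zpow_one_add, ← zpow_add_one]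
      congr 5 <;> push_cast <;> ring
    -- Since `x ^ r` is central, the tensors `w m` have period `r` in `m`.
    have hper : w (orderOf σ) = w 0 := by
      have := center_smul_tmul_op ⟨_, hx⟩ 1 ((x ^ (-orderOf σ : ℤ) : Aˣ) : A)
      simp only [one_mul, ← Units.val_mul] at this
      rw [zpow_neg, zpow_natCast, mul_inv_cancel] at this
      simpa [w] using this
    have hsum : ∑ m ∈ Finset.range (orderOf σ), w (m + 1) =
        ∑ m ∈ Finset.range (orderOf σ), w m := by
      have := Finset.sum_range_sub w (orderOf σ)
      rwa [hper, sub_self, Finset.sum_sub_distrib, sub_eq_zero] at this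
    change _ * ∑ m ∈ _, w m * _ = _ * ∑ m ∈ _, w m * _
    rw [← Finset.sum_mul, ← mul_assoc, ← mul_assoc]
    conv_rhs => rw [← hsum]
    rw [Finset.mul_sum, Finset.mul_sum]
    simp only [hw]
  have hb : b ∈ Subring.closure (Set.range c ∪ {(x : A), ((x⁻¹ : Aˣ) : A)}) :=
    hgen ▸ Subring.mem_top b
  induction hb using Subring.closure_induction with
  | mem b hb =>
    rcases hb with ⟨y, rfl⟩ | rfl | rfl
    · simp only [crossedCasimir, Finset.mul_sum, ← mul_assoc]
      refine Finset.sum_congr rfl fun m _ ↦ ?_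
      -- Move `c y` to the inside of the tensor, where it becomes `c (σ⁻ᵐ y)`.
      have h1 : c y * (x ^ (m : ℤ) : Aˣ) = (x ^ (m : ℤ) : Aˣ) * c ((σ ^ (-m : ℤ)) y) := by
        rw [units_zpow_mul_const h, zpow_neg]
        congr 2
        exact ((σ ^ (m : ℤ)).apply_symm_apply y).symm
      have h2 := units_zpow_mul_const h (-m) y
      rw [Algebra.TensorProduct.tmul_mul_tmul, Algebra.TensorProduct.tmul_mul_tmul, one_mul, one_mul,
        ← op_mul, h1, h2, op_mul]
      have := const_mul_coefficientCasimir hσ hβ hc ((σ ^ (-m : ℤ)) y)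
      calc _ = ((x ^ (m : ℤ) : Aˣ) : A) ⊗ₜ op ((x ^ (-m : ℤ) : Aˣ) : A) *
            ((c ((σ ^ (-m : ℤ)) y) ⊗ₜ 1) * coefficientCasimir c β) := by
            rw [← mul_assoc, Algebra.TensorProduct.tmul_mul_tmul, mul_one]
        _ = _ := by
            rw [this, ← mul_assoc, Algebra.TensorProduct.tmul_mul_tmul, mul_one]
    · exact hx'
    · calc _ = (((x⁻¹ : Aˣ) : A) ⊗ₜ op ((x⁻¹ : Aˣ) : A)) *
            ((1 ⊗ₜ op (x : A)) * crossedCasimir σ c x β) := by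
            rw [← mul_assoc, Algebra.TensorProduct.tmul_mul_tmul, mul_one, ← op_mul, Units.mul_inv,
              op_one]
        _ = _ := by
            rw [← hx', ← mul_assoc, Algebra.TensorProduct.tmul_mul_tmul, mul_one, Units.inv_mul]
  | zero => simp
  | one => rw [op_one]
  | add a b _ _ ha hb => rw [add_tmul, op_add, tmul_add, add_mul, add_mul, ha, hb]
  | neg a _ ha =>
    rw [neg_tmul, op_neg, tmul_neg]
    exact (neg_mul _ _).trans ((congrArg Neg.neg ha).trans (neg_mul _ _).symm)
  | mul a b _ _ ha hb =>
    calc _ = (a ⊗ₜ 1) * ((b ⊗ₜ 1) * crossedCasimir σ c x β) := by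
          rw [← mul_assoc, Algebra.TensorProduct.tmul_mul_tmul, one_mul]
      _ = (1 ⊗ₜ op b) * ((a ⊗ₜ 1) * crossedCasimir σ c x β) := by
          rw [hb, ← mul_assoc, ← mul_assoc]
          simp only [Algebra.TensorProduct.tmul_mul_tmul, one_mul, mul_one]
      _ = _ := by
          rw [ha, ← mul_assoc, Algebra.TensorProduct.tmul_mul_tmul, one_mul, ← op_mul]

/-- The summation over `l` singles out the term `m = n` of `crossedCasimir`, and the summation over
`n` then assembles a trace. -/
theorem sum_mul_crossedCasimir_mul (hσ : 0 < orderOf σ) (h : ∀ a, x * c a = c (σ a) * x)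
    (hβ : ∀ τ : RingAut k, ∑ a, β a * τ a = if τ = 1 then 1 else 0)
    (hc : ∀ a, σ a = a → c a ∈ Subring.center A) :
    ∑ n ∈ Finset.range (orderOf σ), ∑ l, ((c (β l) * (x ^ (-n : ℤ) : Aˣ)) ⊗ₜ 1) *
      (crossedCasimir σ c x β * (c l ⊗ₜ op ((x ^ (n : ℤ) : Aˣ) : A))) = 1 := by
  have hcomm (l : k) (d : A) : coefficientCasimir c β * (c l ⊗ₜ op d) =
      (c l ⊗ₜ 1) * (coefficientCasimir c β * (1 ⊗ₜ op d)) := by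
    simp only [coefficientCasimir, Finset.mul_sum, Finset.sum_mul,
      Algebra.TensorProduct.tmul_mul_tmul, mul_one, one_mul, ← map_mul, mul_comm l]
  have hcoef {m n : ℕ} (hm : m < orderOf σ) (hn : n < orderOf σ) :
      ∑ l, c (β l) * (x ^ (-n : ℤ) : Aˣ) * (x ^ (m : ℤ) : Aˣ) * c l = if m = n then 1 else 0 := by
    have h1 (l : k) : c (β l) * (x ^ (-n : ℤ) : Aˣ) * (x ^ (m : ℤ) : Aˣ) * c l =
        c (β l * (σ ^ (-n + m : ℤ)) l) * (x ^ (-n + m : ℤ) : Aˣ) := by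
      rw [mul_assoc (c (β l)), ← Units.val_mul, ← zpow_add, mul_assoc, units_zpow_mul_const h,
        map_mul, mul_assoc]
    simp only [h1]
    rw [← Finset.sum_mul, ← map_sum, hβ]
    have h2 : σ ^ (-n + m : ℤ) = 1 ↔ m = n := by
      rw [zpow_add, zpow_neg, inv_mul_eq_one, zpow_natCast, zpow_natCast]
      exact ⟨fun e ↦ (pow_injOn_Iio_orderOf hn hm e).symm, fun e ↦ e ▸ rfl⟩
    simp only [h2]
    split_ifs with hmn
    · simp [hmn]
    · simp
  have hterm {n : ℕ} (hn : n ∈ Finset.range (orderOf σ)) :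
      ∑ l, ((c (β l) * (x ^ (-n : ℤ) : Aˣ)) ⊗ₜ 1) *
        (crossedCasimir σ c x β * (c l ⊗ₜ op ((x ^ (n : ℤ) : Aˣ) : A))) =
      ∑ a, c (β a) ⊗ₜ op (c ((σ ^ n) a)) := by
    calc _ = ∑ m ∈ Finset.range (orderOf σ),
          (∑ l, c (β l) * (x ^ (-n : ℤ) : Aˣ) * (x ^ (m : ℤ) : Aˣ) * c l) ⊗ₜ
            op ((x ^ (-m : ℤ) : Aˣ) : A) *
              (coefficientCasimir c β * (1 ⊗ₜ op ((x ^ (n : ℤ) : Aˣ) : A))) := by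
          simp only [crossedCasimir, Finset.sum_mul, Finset.mul_sum, sum_tmul]
          rw [Finset.sum_comm]
          refine Finset.sum_congr rfl fun m _ ↦ Finset.sum_congr rfl fun l _ ↦ ?_
          rw [mul_assoc (_ ⊗ₜ _), hcomm, ← mul_assoc, ← mul_assoc (_ * _)]
          simp only [Algebra.TensorProduct.tmul_mul_tmul, mul_one, one_mul]
      _ = (1 ⊗ₜ op ((x ^ (-n : ℤ) : Aˣ) : A)) *
              (coefficientCasimir c β * (1 ⊗ₜ op ((x ^ (n : ℤ) : Aˣ) : A))) := by
          rw [Finset.sum_eq_single_of_mem n hn]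
          · rw [hcoef (Finset.mem_range.1 hn) (Finset.mem_range.1 hn), if_pos rfl]
          · intro m hm hmn
            rw [hcoef (Finset.mem_range.1 hm) (Finset.mem_range.1 hn), if_neg hmn, zero_tmul,
              zero_mul]
      _ = _ := by
          simp only [coefficientCasimir, Finset.mul_sum, Finset.sum_mul,
            Algebra.TensorProduct.tmul_mul_tmul, mul_one, one_mul, ← op_mul]
          refine Finset.sum_congr rfl fun a _ ↦ ?_
          rw [units_zpow_mul_const h, mul_assoc, ← Units.val_mul, ← zpow_add, add_neg_cancel,
            zpow_zero, Units.val_one, mul_one, zpow_natCast]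
  rw [Finset.sum_congr rfl fun n hn ↦ hterm hn, Finset.sum_comm]
  calc ∑ a, ∑ n ∈ Finset.range (orderOf σ), c (β a) ⊗ₜ[Subring.center A] op (c ((σ ^ n) a))
      = ∑ a, c (β a * cyclicTrace σ a) ⊗ₜ 1 := Finset.sum_congr rfl fun a _ ↦ by
        have := center_smul_tmul_op ⟨_, hc _ (apply_cyclicTrace σ a)⟩ (c (β a)) 1
        rw [mul_one, op_one] at this
        rw [map_mul, this, ← tmul_sum, ← Finset.op_sum, ← map_sum]; rfl
    _ = 1 := by
        rw [← sum_tmul, ← map_sum]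
        have := sum_mul_cyclicTrace hσ hβ 1
        simp only [mul_one] at this
        rw [this, map_one, Algebra.TensorProduct.one_def]

end Fintype

/-- A ring generated by `c k` and a unit `x` that induces `σ` on `c k` by conjugation is Azumaya over
its centre, provided that `x ^ orderOf σ` and the constants fixed by `σ` are central. -/
theorem isAzumaya_of_crossedProduct [Finite k] (hσ : 0 < orderOf σ)
    (h : ∀ a, x * c a = c (σ a) * x) (hc : ∀ a, σ a = a → c a ∈ Subring.center A)
    (hx : ((x ^ orderOf σ : Aˣ) : A) ∈ Subring.center A)
    (hgen : Subring.closure (Set.range c ∪ {(x : A), ((x⁻¹ : Aˣ) : A)}) = ⊤) :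
    IsAzumaya (Subring.center A) A := by
  classical
  have := Fintype.ofFinite k
  obtain ⟨β, hβ⟩ := exists_sum_mul_ringAut_eq_ite k
  refine isAzumaya_of_casimir (ι := Fin (orderOf σ) × k)
    (fun i ↦ c (β i.2) * (x ^ (-(i.1 : ℕ) : ℤ) : Aˣ))
    (fun i ↦ crossedCasimir σ c x β * (c i.2 ⊗ₜ op ((x ^ ((i.1 : ℕ) : ℤ) : Aˣ) : A)))
    (fun i b ↦ ?_) ?_
  · rw [← mul_assoc, mul_crossedCasimir hσ h hβ hc hx hgen, mul_assoc]
  · rw [Fintype.sum_prod_type, ← sum_mul_crossedCasimir_mul hσ h hβ hc, Finset.sum_range]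

end CrossedProduct

/-! ### Coefficients of skew polynomials -/

section SkewPoly

variable {k : Type*} [Field k] {σ : RingAut k}

theorem twist_φ_iterate (n : ℕ) (a : k) :
    SkewPolynomial.φ^[n] (Twist.of σ a) = Twist.of σ ((σ ^ n) a) := by
  rw [SkewPolynomial.φ_iterate_apply]; rfl

theorem SkewPoly.coeff_sum {ι : Type*} (s : Finset ι) (f : ι → SkewPoly σ) (n : ℕ) :
    SkewPolynomial.coeff (∑ i ∈ s, f i) n = ∑ i ∈ s, (f i).coeff n :=
  map_sum (⟨⟨fun p ↦ p.coeff n, SkewPolynomial.coeff_zero n⟩,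
    fun p q ↦ SkewPolynomial.coeff_add p q n⟩ : SkewPoly σ →+ Twist σ) f s

theorem SkewPoly.coeff_X_mul (p : SkewPoly σ) (n : ℕ) :
    (SkewPolynomial.X * p).coeff (n + 1) = SkewPolynomial.φ (p.coeff n) := by
  induction p using SkewPolynomial.induction with
  | h0 => simp
  | ha m a q _ _ ih =>
    rw [mul_add, SkewPolynomial.coeff_add, ih, SkewPolynomial.coeff_add, map_add,
      SkewPolynomial.X_mul_monomial, SkewPolynomial.coeff_monomial, SkewPolynomial.coeff_monomial,
      apply_ite SkewPolynomial.φ, map_zero]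
    simp

theorem SkewPoly.coeff_const_mul (p : SkewPoly σ) (a : k) (n : ℕ) :
    (const σ a * p).coeff n = Twist.of σ a * p.coeff n := by
  induction p using SkewPolynomial.induction with
  | h0 => simp
  | ha m b q _ _ ih =>
    change (SkewPolynomial.C (Twist.of σ a) * _).coeff n = _
    change (SkewPolynomial.C (Twist.of σ a) * _).coeff n = _ at ih
    rw [mul_add, SkewPolynomial.coeff_add, ih, SkewPolynomial.coeff_add, mul_add,
      SkewPolynomial.C_mul_monomial, SkewPolynomial.coeff_monomial, SkewPolynomial.coeff_monomial,
      mul_ite, mul_zero]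

theorem SkewPoly.coeff_mul_const (p : SkewPoly σ) (a : k) (n : ℕ) :
    (p * const σ a).coeff n = p.coeff n * Twist.of σ ((σ ^ n) a) := by
  induction p using SkewPolynomial.induction with
  | h0 => simp
  | ha m b q _ _ ih =>
    change (_ * SkewPolynomial.C (Twist.of σ a)).coeff n = _
    change (_ * SkewPolynomial.C (Twist.of σ a)).coeff n = _ at ih
    rw [add_mul, SkewPolynomial.coeff_add, ih, SkewPolynomial.coeff_add, add_mul,
      SkewPolynomial.monomial_mul_C, SkewPolynomial.coeff_monomial, SkewPolynomial.coeff_monomial,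
      ite_mul, zero_mul, twist_φ_iterate]
    congr 1
    split_ifs with h
    · rw [h]
    · rfl

/-- A skew polynomial commuting with `X` and the constants involves only powers of `X` whose
exponent is a multiple of the order of `σ`, with coefficients fixed by `σ`. -/
theorem SkewPoly.coeff_of_commute (p : SkewPoly σ)
    (hX : SkewPolynomial.X * p = p * SkewPolynomial.X)
    (hc : ∀ a, const σ a * p = p * const σ a) {n : ℕ} (hn : p.coeff n ≠ 0) :
    orderOf σ ∣ n ∧ σ ((Twist.of σ).symm (p.coeff n)) = (Twist.of σ).symm (p.coeff n) := by
  constructor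
  · refine orderOf_dvd_of_pow_eq_one (RingEquiv.ext fun a ↦ ?_)
    have h := congrArg (fun q : SkewPoly σ ↦ SkewPolynomial.coeff q n) (hc a)
    simp only [coeff_const_mul, coeff_mul_const] at h
    rw [mul_comm, mul_right_inj' hn] at h
    exact ((Twist.of σ).injective h).symm
  · have h := congrArg (fun q : SkewPoly σ ↦ SkewPolynomial.coeff q (n + 1)) hX
    simp only [coeff_X_mul, coeff_mul_X] at h
    exact h

end SkewPoly

/-! ### Generators and the centre of the skew Laurent polynomials -/

namespace SkewLaurent

variable {k : Type*} [Field k] (σ : RingAut k)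

theorem ofPoly_injective : Function.Injective (ofPoly σ) := by
  refine OreLocalization.numeratorHom_inj ?_
  rintro _ ⟨n, rfl⟩ p hp
  induction n with
  | zero => simpa using hp
  | succ n ih =>
    apply ih
    ext m
    have h : SkewPolynomial.coeff
        (SkewPolynomial.X * (SkewPolynomial.X ^ n * p) : SkewPoly σ) (m + 1) = 0 := by
      rw [← mul_assoc, ← pow_succ', show _ * p = 0 from hp, SkewPolynomial.coeff_zero]
    rw [SkewPoly.coeff_X_mul] at h
    exact (map_eq_zero _).1 h

/-- The variable as a unit of `k[X, σ][1/X]`. -/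
noncomputable def unitX : (SkewLaurent σ)ˣ :=
  OreLocalization.numeratorUnit ⟨SkewPolynomial.X, Submonoid.mem_powers _⟩

theorem val_unitX : (unitX σ : SkewLaurent σ) = X σ := rfl

theorem unitX_mul_const (a : k) : unitX σ * const σ a = const σ (σ a) * unitX σ := by
  rw [val_unitX, X, const, RingHom.comp_apply, ← map_mul, SkewPoly.X_mul_const, map_mul]; rfl

/-- Every element of `k[X, σ][1/X]` is a left fraction `X⁻ⁿ p`. -/
theorem exists_X_pow_mul_eq (z : SkewLaurent σ) :
    ∃ (n : ℕ) (p : SkewPoly σ), X σ ^ n * z = ofPoly σ p := by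
  induction z using OreLocalization.ind with | _ r s
  obtain ⟨_, n, rfl⟩ := s
  refine ⟨n, r, ?_⟩
  rw [X, ← map_pow]
  exact OreLocalization.mul_cancel

theorem ofPoly_monomial (n : ℕ) (a : Twist σ) :
    ofPoly σ (SkewPolynomial.monomial n a) = const σ ((Twist.of σ).symm a) * X σ ^ n := by
  rw [← SkewPolynomial.C_mul_X_pow_eq_monomial, map_mul, map_pow]; rfl

theorem ofPoly_eq_sum (p : SkewPoly σ) : ofPoly σ p =
    ∑ n ∈ p.support, const σ ((Twist.of σ).symm (p.coeff n)) * X σ ^ n := by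
  conv_lhs => rw [← SkewPolynomial.sum_monomial p, SkewPolynomial.sum_def, map_sum]
  exact Finset.sum_congr rfl fun n _ ↦ ofPoly_monomial σ n _

theorem closure_eq_top :
    Subring.closure (Set.range (const σ) ∪
      {(unitX σ : SkewLaurent σ), (((unitX σ)⁻¹ : (SkewLaurent σ)ˣ) : SkewLaurent σ)}) = ⊤ := by
  refine eq_top_iff.2 fun z _ ↦ ?_
  obtain ⟨n, p, hp⟩ := exists_X_pow_mul_eq σ z
  have hz : z = (((unitX σ)⁻¹ ^ n : (SkewLaurent σ)ˣ) : SkewLaurent σ) * ofPoly σ p := by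
    rw [← hp, ← val_unitX, ← Units.val_pow_eq_pow_val, ← mul_assoc, ← Units.val_mul, inv_pow,
      inv_mul_cancel, Units.val_one, one_mul]
  rw [hz, Units.val_pow_eq_pow_val, ofPoly_eq_sum]
  refine mul_mem (pow_mem (Subring.subset_closure (by simp)) _)
    (sum_mem fun i _ ↦ mul_mem (Subring.subset_closure (by simp))
      (pow_mem (Subring.subset_closure (by simp [val_unitX])) _))

/-- An element commuting with the constants and the variable is central. -/
theorem mem_center_of_commute {z : SkewLaurent σ} (hc : ∀ a, const σ a * z = z * const σ a)
    (hX : X σ * z = z * X σ) : z ∈ Subring.center (SkewLaurent σ) := by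
  have : (⊤ : Subring (SkewLaurent σ)) ≤ Subring.centralizer {z} := by
    rw [← closure_eq_top, Subring.closure_le]
    rintro _ (⟨a, rfl⟩ | rfl | rfl) w rfl
    · exact (hc a).symm
    · exact hX.symm
    · exact (Units.inv_mul_eq_iff_eq_mul _ |>.2 <| by
        rw [← mul_assoc, Units.eq_mul_inv_iff_mul_eq]; exact hX.symm).symm
  exact Subring.mem_center_iff.2 fun w ↦ (this (Subring.mem_top w) z rfl).symm

theorem const_mem_center {a : k} (ha : σ a = a) : const σ a ∈ Subring.center (SkewLaurent σ) := by
  refine mem_center_of_commute σ (fun b ↦ by rw [← map_mul, mul_comm, map_mul]) ?_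
  rw [← val_unitX, unitX_mul_const, ha]

theorem unitX_pow_orderOf_mem_center :
    ((unitX σ ^ orderOf σ : (SkewLaurent σ)ˣ) : SkewLaurent σ) ∈
      Subring.center (SkewLaurent σ) := by
  refine mem_center_of_commute σ (fun b ↦ ?_) ?_
  · have := units_zpow_mul_const (unitX_mul_const σ) (orderOf σ) b
    rw [zpow_natCast, zpow_natCast, pow_orderOf_eq_one] at this
    exact this.symm
  · rw [Units.val_pow_eq_pow_val, val_unitX, ← pow_succ', pow_succ]

/-- `X ^ r`, with `r` the order of `σ`, as a unit of the centre. -/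
noncomputable def centralUnit : (Subring.center (SkewLaurent σ))ˣ where
  val := ⟨_, unitX_pow_orderOf_mem_center σ⟩
  inv := ⟨((unitX σ ^ orderOf σ)⁻¹ : (SkewLaurent σ)ˣ),
    Set.units_inv_mem_center (unitX_pow_orderOf_mem_center σ)⟩
  val_inv := Subtype.ext (Units.mul_inv (unitX σ ^ orderOf σ))
  inv_val := Subtype.ext (Units.inv_mul (unitX σ ^ orderOf σ))

theorem val_centralUnit :
    ((centralUnit σ : Subring.center (SkewLaurent σ)) : SkewLaurent σ) = X σ ^ orderOf σ :=
  Units.val_pow_eq_pow_val (unitX σ) (orderOf σ)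

/-- The inclusion of `k^σ` in the centre as the constants. -/
noncomputable def centralConst : fixedSubfield σ →+* Subring.center (SkewLaurent σ) :=
  ((const σ).comp (fixedSubfield σ).subtype).codRestrict _ fun a ↦ const_mem_center σ a.2

/-- The map `k^σ[T, T⁻¹] → k[X, σ][1/X]`, `T ↦ X ^ r`, with values in the centre. -/
noncomputable def laurentToCenter :
    LaurentPolynomial (fixedSubfield σ) →+* Subring.center (SkewLaurent σ) :=
  LaurentPolynomial.eval₂ (centralConst σ) (centralUnit σ)

theorem laurentToCenter_C (a : fixedSubfield σ) :
    (laurentToCenter σ (LaurentPolynomial.C a) : SkewLaurent σ) = const σ a := by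
  rw [laurentToCenter, LaurentPolynomial.eval₂_C]; rfl

theorem laurentToCenter_T (n : ℤ) :
    laurentToCenter σ (LaurentPolynomial.T n) = ((centralUnit σ ^ n : (Subring.center _)ˣ) :
      Subring.center (SkewLaurent σ)) := by
  rw [laurentToCenter, LaurentPolynomial.eval₂_T]

theorem laurentToCenter_toLaurent (q : Polynomial (fixedSubfield σ)) :
    (laurentToCenter σ (Polynomial.toLaurent q) : SkewLaurent σ) =
      ofPoly σ (∑ n ∈ q.support,
        SkewPolynomial.monomial (orderOf σ * n) (Twist.of σ (q.coeff n : k))) := by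
  rw [laurentToCenter, LaurentPolynomial.eval₂_toLaurent, Polynomial.eval₂_eq_sum,
    Polynomial.sum_def, AddSubmonoidClass.coe_finsetSum, map_sum]
  refine Finset.sum_congr rfl fun n _ ↦ ?_
  rw [ofPoly_monomial, Subring.coe_mul, SubmonoidClass.coe_pow, val_centralUnit, pow_mul]; rfl

theorem laurentToCenter_injective (hσ : 0 < orderOf σ) :
    Function.Injective (laurentToCenter σ) := by
  refine (injective_iff_map_eq_zero _).2 fun f hf ↦ ?_
  obtain ⟨n, q, hq⟩ := f.exists_T_pow
  have h0 : laurentToCenter σ (Polynomial.toLaurent q) = 0 := by rw [hq, map_mul, hf, zero_mul]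
  have h1 := laurentToCenter_toLaurent σ q
  rw [h0, ZeroMemClass.coe_zero, eq_comm, map_eq_zero_iff _ (ofPoly_injective σ)] at h1
  have hq0 : q = 0 := by
    ext m
    have h2 := congrArg (fun p : SkewPoly σ ↦ SkewPolynomial.coeff p (orderOf σ * m)) h1
    simp only [SkewPoly.coeff_sum, SkewPolynomial.coeff_monomial,
      mul_right_inj' hσ.ne', Finset.sum_ite_eq', SkewPolynomial.coeff_zero] at h2
    by_cases hm : m ∈ q.support
    · rw [if_pos hm] at h2
      exact (map_eq_zero _).1 h2
    · rw [Polynomial.notMem_support_iff.1 hm]; rfl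
  rw [hq0, map_zero, eq_comm] at hq
  exact (LaurentPolynomial.isUnit_T (R := fixedSubfield σ) n).mul_left_eq_zero.1 hq

theorem laurentToCenter_surjective (hσ : 0 < orderOf σ) :
    Function.Surjective (laurentToCenter σ) := by
  intro z
  obtain ⟨n, p, hp⟩ := exists_X_pow_mul_eq σ (z : SkewLaurent σ)
  -- Choose a denominator that is a power of `X ^ r`, so that the numerator is central as well.
  let w := (centralUnit σ : Subring.center (SkewLaurent σ)) ^ n * z
  obtain ⟨q, hq⟩ : ∃ q, (w : SkewLaurent σ) = ofPoly σ q := by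
    refine ⟨SkewPolynomial.X ^ (orderOf σ * n - n) * p, ?_⟩
    rw [map_mul, map_pow, ← hp, Subring.coe_mul, SubmonoidClass.coe_pow, val_centralUnit,
      ← mul_assoc, ← pow_mul]
    change _ = X σ ^ _ * X σ ^ n * _
    rw [← pow_add, Nat.sub_add_cancel (Nat.le_mul_of_pos_left n hσ)]
  have hcomm (u : SkewPoly σ) : u * q = q * u := ofPoly_injective σ <| by
    rw [map_mul, map_mul, ← hq]
    exact Subring.mem_center_iff.1 w.2 _
  have hw : w ∈ (laurentToCenter σ).range := by
    have hcoeff {m : ℕ} (hm : m ∈ q.support) :=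
      SkewPoly.coeff_of_commute q (hcomm _) (fun a ↦ hcomm _) (SkewPolynomial.mem_support_iff.1 hm)
    have hsum : w = ∑ m ∈ q.support.attach,
        centralConst σ ⟨_, (hcoeff m.2).2⟩ *
          (centralUnit σ : Subring.center _) ^ (m / orderOf σ) := by
      apply Subtype.ext
      rw [hq, ofPoly_eq_sum, AddSubmonoidClass.coe_finsetSum, ← Finset.sum_attach]
      refine Finset.sum_congr rfl fun m _ ↦ ?_
      rw [Subring.coe_mul, SubmonoidClass.coe_pow, val_centralUnit, ← pow_mul,
        Nat.mul_div_cancel' (hcoeff m.2).1]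
      rfl
    rw [hsum]
    refine sum_mem fun m _ ↦ mul_mem (RingHom.mem_range.2
      ⟨LaurentPolynomial.C ⟨_, (hcoeff m.2).2⟩, ?_⟩)
      (pow_mem (RingHom.mem_range.2 ⟨LaurentPolynomial.T 1, ?_⟩) _)
    · exact LaurentPolynomial.eval₂_C _ _ _
    · rw [laurentToCenter_T, zpow_one]
  obtain ⟨f, hf⟩ := hw
  refine ⟨LaurentPolynomial.T (-n) * f, ?_⟩
  rw [map_mul, hf, laurentToCenter_T, zpow_neg, zpow_natCast, Units.inv_mul_eq_iff_eq_mul,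
    Units.val_pow_eq_pow_val]

end SkewLaurent

/-! ### The centre and the Azumaya property -/

theorem theorem1p1 {k : Type*} [Field k] [Finite k] (σ : RingAut k) :
    (∃ e : LaurentPolynomial (fixedSubfield σ) ≃+* Subring.center (SkewLaurent σ),
      (∀ a : fixedSubfield σ,
        (e (LaurentPolynomial.C a) : SkewLaurent σ) = SkewLaurent.const σ a) ∧
      (e (LaurentPolynomial.T 1) : SkewLaurent σ) = SkewLaurent.X σ ^ orderOf σ) ∧
    IsAzumaya (Subring.center (SkewLaurent σ)) (SkewLaurent σ) := by
  have := finite_ringAut k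
  have hσ : 0 < orderOf σ := orderOf_pos σ
  have hbij : Function.Bijective (SkewLaurent.laurentToCenter σ) :=
    ⟨SkewLaurent.laurentToCenter_injective σ hσ, SkewLaurent.laurentToCenter_surjective σ hσ⟩
  refine ⟨⟨RingEquiv.ofBijective _ hbij, SkewLaurent.laurentToCenter_C σ, ?_⟩, ?_⟩
  · rw [RingEquiv.ofBijective_apply, SkewLaurent.laurentToCenter_T, zpow_one,
      SkewLaurent.val_centralUnit]
  · exact isAzumaya_of_crossedProduct hσ (SkewLaurent.unitX_mul_const σ)
      (fun a ↦ SkewLaurent.const_mem_center σ) (SkewLaurent.unitX_pow_orderOf_mem_center σ)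
      (SkewLaurent.closure_eq_top σ)
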